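/- **Theorem 1.2.** Call an ordered triple $(x,y,z)$ of elements of a set $A\subseteq\{2,3,4,\dots\}$ with $xy=z$ a solution in $A$, and call it non-degenerate if $x,y,z$ are pairwise distinct; $\log$ is the natural logarithm. (a) For every $\varepsilon>0$ there is $N_0$ such that for every $N\ge N_0$ and every colouring of $\{2,\dots,N\}$ with two colours, there is a single colour class that contains at least $$\left(\frac{1}{2\sqrt2}-\varepsilon\right)N^{1/2}\log N$$ non-degenerate solutions to $xy=z$. (b) The constant $\frac1{2\sqrt2}$ is sharp. For $N\ge 1$, colour the integers in $[2,(N/2)^{1/2}]\cup(N/2,N]$ red and the remaining integers of $\{2,\dots,N\}$, those in $((N/2)^{1/2},N/2]$, blue. Then there is no blue solution to $xy=z$ (degenerate or not), and the number of red non-degenerate solutions is $$\frac{1}{2\sqrt2}N^{1/2}\log N+O(N^{1/2})\qquad(N\to\infty).$$ -/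

import Mathlib

open Filter Asymptotics

/-- The ordered solutions `(x, y, z)` of `x * y = z` with all of `x`, `y`, `z` in `A`. -/
def mulSolutions (A : Finset ℕ) : Finset (ℕ × ℕ × ℕ) :=
  (A ×ˢ A ×ˢ A).filter fun s => s.1 * s.2.1 = s.2.2

/-- The non-degenerate solutions of `x * y = z` in `A`: those with `x`, `y`, `z` pairwise
distinct. -/
def nondegMulSolutions (A : Finset ℕ) : Finset (ℕ × ℕ × ℕ) :=
  (mulSolutions A).filter fun s => s.1 ≠ s.2.1 ∧ s.1 ≠ s.2.2 ∧ s.2.1 ≠ s.2.2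

/-- The set of elements of `{2, …, N}` that receive colour `i` under the colouring `c` of
`{2, …, N}` with colours `0` and `1`. -/
def colourClass {N : ℕ} (c : Finset.Icc 2 N → Fin 2) (i : Fin 2) : Finset ℕ :=
  (Finset.univ.filter fun n => c n = i).map (Function.Embedding.subtype _)

/-- The colouring of `{2, …, N}` in which `[2, (N/2)^{1/2}] ∪ (N/2, N]` is red (colour `0`)
and the remaining part `((N/2)^{1/2}, N/2]` is blue (colour `1`). -/
noncomputable def extremalColouring (N : ℕ) : Finset.Icc 2 N → Fin 2 := fun n =>
  if ((n : ℕ) : ℝ) ≤ √((N : ℝ) / 2) ∨ (N : ℝ) / 2 < ((n : ℕ) : ℝ) then 0 else 1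

/-! Write `S` for the set of monochromatic pairs. Suppose both classes have too few solutions, so
that `S` has size `O(√N log N)`, and let `L` be about a small power of `N`. If some `x` differs in
colour from `2`, then every `y ≤ N / (4x)` produces a pair of `S` built from `2`, `x` and `y`
(`exists_mono_of_ne`), so `S` has order at least `N / x`. Hence every `x ≤ √(2N) / L` has the colour
of `2`. Now take `a, b ≥ L` with `ab ≤ √(N/2)`; both have the colour of `2`. If `ab` has it as well,
`(a, b)` is a solution in that colour. Otherwise multiply `b` by the power of `2` that brings the
product into `(√(N/2), √(2N)]`. As `a ≥ L`, the new second factor still has the colour of `2`, and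
so does the new product unless `ab` is exceptional, meaning that `z = ab` and some `2^k z ≤ √(2N)`
both miss that colour. Exceptional `z` are few: for fixed `k`, each pair of them yields a member of
`S`, so by the divisor bound there are only `N^(1/4)` of them up to a small power of `N`
(`card_exceptionalSet_le`). Off the exceptional products the lift is injective
(`card_truncatedHyperbolaPairs_le`). So one class has about `M log M` solutions with `M = √(N/2)`,
which is `√N log N / (2√2)` to leading order. For sharpness, the red solutions of the extremal
colouring are exactly the non-degenerate factorisations of integers up to `√(N/2)`, and the same
hyperbola count applies. -/

/-! ### Divisor bound -/

theorem exists_add_one_le_mul_two_rpow {ε : ℝ} (hε : 0 < ε) :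
    ∃ A : ℝ, 1 ≤ A ∧ ∀ v : ℕ, (v : ℝ) + 1 ≤ A * (2 : ℝ) ^ (v * ε) := by
  have hl : 0 < ε * Real.log 2 := mul_pos hε (Real.log_pos (by norm_num))
  refine ⟨max 1 (1 / (ε * Real.log 2)), le_max_left _ _, fun v => ?_⟩
  set A := max 1 (1 / (ε * Real.log 2))
  have h1 : (1 : ℝ) ≤ A := le_max_left _ _
  have h2 : 1 ≤ A * (ε * Real.log 2) := by
    have : 1 / (ε * Real.log 2) ≤ A := le_max_right _ _
    rwa [div_le_iff₀ hl] at this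
  have h3 : v * (ε * Real.log 2) + 1 ≤ (2 : ℝ) ^ (v * ε) := by
    rw [Real.rpow_def_of_pos (by norm_num)]
    refine le_trans (le_of_eq ?_) (Real.add_one_le_exp _)
    ring
  have hv : (0 : ℝ) ≤ v := v.cast_nonneg
  calc (v : ℝ) + 1 ≤ v * (A * (ε * Real.log 2)) + A := by nlinarith
    _ = A * (v * (ε * Real.log 2) + 1) := by ring
    _ ≤ _ := by gcongr

/-- The divisor bound. -/
theorem exists_card_divisors_le_mul_rpow {ε : ℝ} (hε : 0 < ε) :
    ∃ C : ℝ, 1 ≤ C ∧ ∀ n : ℕ, (n.divisors.card : ℝ) ≤ C * (n : ℝ) ^ ε := by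
  obtain ⟨A, hA1, hA⟩ := exists_add_one_le_mul_two_rpow hε
  -- In the product of `(v + 1) / p^(vε)` over primes, a prime `p ≥ 2^(1/ε)` has `p^ε ≥ 2` and
  -- contributes at most `1`, since `v + 1 ≤ 2^v`. Each of the fewer than `Q` smaller primes
  -- contributes at most `A`.
  set Q : ℕ := ⌈(2 : ℝ) ^ (1 / ε)⌉₊
  refine ⟨A ^ Q, one_le_pow₀ hA1, fun n => ?_⟩
  rcases eq_or_ne n 0 with rfl | hn
  · simp [Real.zero_rpow hε.ne']
  have hpow : (n : ℝ) ^ ε = ∏ p ∈ n.primeFactors, (p : ℝ) ^ (n.factorization p * ε) := by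
    conv_lhs => rw [← Nat.prod_factorization_pow_eq_self hn]
    rw [Finsupp.prod, Nat.cast_prod, ← Real.finsetProd_rpow _ _ (fun _ _ => by positivity)]
    refine Finset.prod_congr rfl fun p _ => ?_
    rw [Nat.cast_pow, ← Real.rpow_natCast, ← Real.rpow_mul (by positivity)]
  have hfac : ∀ p ∈ n.primeFactors, ((n.factorization p + 1 : ℕ) : ℝ) ≤
      (if p < Q then A else 1) * (p : ℝ) ^ (n.factorization p * ε) := by
    intro p hp
    have hp2 : (2 : ℝ) ≤ p := by exact_mod_cast (Nat.prime_of_mem_primeFactors hp).two_le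
    push_cast
    split_ifs with h
    · refine (hA _).trans ?_
      gcongr
    · rw [one_mul]
      have hQ : (2 : ℝ) ^ (1 / ε) ≤ p :=
        (Nat.le_ceil _).trans (by exact_mod_cast not_lt.1 h)
      have h2 : (2 : ℝ) ≤ (p : ℝ) ^ ε := by
        calc (2 : ℝ) = ((2 : ℝ) ^ (1 / ε)) ^ ε := by
              rw [← Real.rpow_mul (by norm_num), one_div_mul_cancel hε.ne', Real.rpow_one]
          _ ≤ _ := by gcongr
      have h3 : (n.factorization p : ℝ) + 1 ≤ 2 ^ n.factorization p := by
        exact_mod_cast Nat.lt_two_pow_self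
      calc _ ≤ (2 : ℝ) ^ n.factorization p := h3
        _ ≤ ((p : ℝ) ^ ε) ^ n.factorization p := by gcongr
        _ = _ := by
          rw [← Real.rpow_natCast, ← Real.rpow_mul (by positivity), mul_comm]
  rw [Nat.card_divisors hn, Nat.cast_prod, hpow]
  refine (Finset.prod_le_prod (fun _ _ => by positivity) hfac).trans ?_
  rw [Finset.prod_mul_distrib]
  gcongr
  rw [Finset.prod_ite, Finset.prod_const, Finset.prod_const_one, mul_one]
  refine pow_le_pow_right₀ hA1 ?_
  calc _ ≤ (Finset.range Q).card := Finset.card_le_card fun p hp => by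
        simpa using (Finset.mem_filter.1 hp).2
    _ = Q := Finset.card_range Q

/-! ### Lattice points under a hyperbola -/

/-- The pairs of positive integers with product at most `M`. -/
def hyperbolaPairs (M : ℕ) : Finset (ℕ × ℕ) :=
  (Finset.Icc 1 M ×ˢ Finset.Icc 1 M).filter fun p => p.1 * p.2 ≤ M

theorem mem_hyperbolaPairs {M : ℕ} {p : ℕ × ℕ} :
    p ∈ hyperbolaPairs M ↔ 1 ≤ p.1 ∧ 1 ≤ p.2 ∧ p.1 * p.2 ≤ M := by
  simp only [hyperbolaPairs, Finset.mem_filter, Finset.mem_product, Finset.mem_Icc]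
  constructor
  · tauto
  · rintro ⟨h1, h2, h3⟩
    exact ⟨⟨⟨h1, by nlinarith⟩, h2, by nlinarith⟩, h3⟩

theorem card_hyperbolaPairs_filter (M : ℕ) (P : ℕ → Prop) [DecidablePred P] :
    ((hyperbolaPairs M).filter fun p => P p.1).card =
      ∑ a ∈ (Finset.Icc 1 M).filter P, M / a := by
  rw [Finset.card_eq_sum_card_fiberwise (f := Prod.fst) (t := (Finset.Icc 1 M).filter P)]
  · refine Finset.sum_congr rfl fun a ha => ?_
    simp only [Finset.mem_filter, Finset.mem_Icc] at ha
    rw [show M / a = (Finset.Icc 1 (M / a)).card by simp]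
    refine Finset.card_nbij' Prod.snd (fun b => (a, b)) ?_ ?_ ?_ ?_
    · rintro ⟨x, y⟩ h
      simp only [Finset.coe_filter, Set.mem_ofPred_eq, Finset.mem_filter, mem_hyperbolaPairs] at h
      obtain ⟨⟨⟨_, h2, h3⟩, _⟩, rfl⟩ := h
      simp only [Finset.coe_Icc, Set.mem_Icc]
      exact ⟨h2, (Nat.le_div_iff_mul_le (by omega)).2 (by rwa [mul_comm])⟩
    · intro b h
      simp only [Finset.coe_Icc, Set.mem_Icc] at h
      have := (Nat.le_div_iff_mul_le (by omega)).1 h.2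
      simp only [Finset.coe_filter, Set.mem_ofPred_eq, Finset.mem_filter, mem_hyperbolaPairs]
      exact ⟨⟨⟨ha.1.1, h.1, by rwa [mul_comm]⟩, ha.2⟩, trivial⟩
    · rintro ⟨x, y⟩ h
      simp only [Finset.coe_filter, Set.mem_ofPred_eq] at h
      simp [h.2]
    · exact fun _ _ => rfl
  · rintro ⟨x, y⟩ h
    simp only [Finset.coe_filter, Set.mem_ofPred_eq, mem_hyperbolaPairs, Finset.mem_Icc] at h ⊢
    exact ⟨⟨h.1.1, by nlinarith⟩, h.2⟩

theorem harmonic_cast_eq_sum (n : ℕ) :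
    ((harmonic n : ℚ) : ℝ) = ∑ a ∈ Finset.Icc 1 n, (1 : ℝ) / a := by
  rw [harmonic_eq_sum_Icc]; push_cast; simp

theorem card_hyperbolaPairs_le (M : ℕ) :
    ((hyperbolaPairs M).card : ℝ) ≤ M * Real.log M + M := by
  have h := card_hyperbolaPairs_filter M (fun _ => True)
  simp only [Finset.filter_true] at h
  rw [h, Nat.cast_sum]
  calc ∑ a ∈ Finset.Icc 1 M, ((M / a : ℕ) : ℝ) ≤ ∑ a ∈ Finset.Icc 1 M, (M : ℝ) * (1 / a) :=
        Finset.sum_le_sum fun a _ => by rw [mul_one_div]; exact Nat.cast_div_le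
    _ = M * ((harmonic M : ℚ) : ℝ) := by rw [← Finset.mul_sum, harmonic_cast_eq_sum]
    _ ≤ M * (1 + Real.log M) := by gcongr; exact harmonic_le_one_add_log M
    _ = _ := by ring

theorem le_card_hyperbolaPairs (M : ℕ) :
    M * Real.log M - M ≤ ((hyperbolaPairs M).card : ℝ) := by
  rcases Nat.eq_zero_or_pos M with rfl | hM
  · simp
  have h := card_hyperbolaPairs_filter M (fun _ => True)
  simp only [Finset.filter_true] at h
  rw [h, Nat.cast_sum]
  calc M * Real.log M - M ≤ M * ((harmonic M : ℚ) : ℝ) - M := by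
        gcongr
        refine le_trans ?_ (log_add_one_le_harmonic M)
        exact Real.log_le_log (by exact_mod_cast hM) (by push_cast; linarith)
    _ = ∑ a ∈ Finset.Icc 1 M, ((M : ℝ) * (1 / a) - 1) := by
        rw [harmonic_cast_eq_sum, Finset.sum_sub_distrib, Finset.mul_sum]; simp
    _ ≤ _ := Finset.sum_le_sum fun a _ => by
        rw [mul_one_div]
        have := Nat.lt_floor_add_one ((M : ℝ) / a)
        rw [Nat.floor_div_eq_div] at this
        linarith

theorem card_hyperbolaPairs_filter_fst_lt_le (M L : ℕ) :
    (((hyperbolaPairs M).filter fun p => p.1 < L).card : ℝ) ≤ M * (1 + Real.log L) := by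
  rw [card_hyperbolaPairs_filter M (· < L), Nat.cast_sum]
  calc ∑ a ∈ (Finset.Icc 1 M).filter (· < L), ((M / a : ℕ) : ℝ)
      ≤ ∑ a ∈ (Finset.Icc 1 M).filter (· < L), (M : ℝ) * (1 / a) :=
        Finset.sum_le_sum fun a _ => by rw [mul_one_div]; exact Nat.cast_div_le
    _ ≤ ∑ a ∈ Finset.Icc 1 L, (M : ℝ) * (1 / a) := by
        refine Finset.sum_le_sum_of_subset_of_nonneg (fun a ha => ?_) fun _ _ _ => by positivity
        simp only [Finset.mem_filter, Finset.mem_Icc] at ha ⊢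
        omega
    _ = M * ((harmonic L : ℚ) : ℝ) := by rw [← Finset.mul_sum, harmonic_cast_eq_sum]
    _ ≤ _ := by gcongr; exact harmonic_le_one_add_log L

/-- The pairs of integers, both at least `L`, with product at most `M`. -/
def truncatedHyperbolaPairs (L M : ℕ) : Finset (ℕ × ℕ) :=
  (hyperbolaPairs M).filter fun p => L ≤ p.1 ∧ L ≤ p.2

/-- Discarding the two thin strips costs `O(M log L)`, negligible against `M log M` when `L` is a
small power of `N`. -/
theorem le_card_truncatedHyperbolaPairs (M L : ℕ) :
    M * Real.log M - M - 2 * (M * (1 + Real.log L)) ≤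
      ((truncatedHyperbolaPairs L M).card : ℝ) := by
  have hsub : hyperbolaPairs M ⊆ truncatedHyperbolaPairs L M ∪
      ((hyperbolaPairs M).filter (fun p => p.1 < L) ∪
        ((hyperbolaPairs M).filter fun p => p.1 < L).image Prod.swap) := by
    rintro ⟨a, b⟩ h
    have h' : (b, a) ∈ hyperbolaPairs M := by
      rw [mem_hyperbolaPairs] at h ⊢
      exact ⟨h.2.1, h.1, by rw [mul_comm]; exact h.2.2⟩
    simp only [truncatedHyperbolaPairs, Finset.mem_union, Finset.mem_filter, Finset.mem_image,
      Prod.exists]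
    rcases lt_or_ge a L with ha | ha
    · exact Or.inr (Or.inl ⟨h, ha⟩)
    rcases lt_or_ge b L with hb | hb
    · exact Or.inr (Or.inr ⟨b, a, ⟨h', hb⟩, rfl⟩)
    · exact Or.inl ⟨h, ha, hb⟩
  have h1 := (Finset.card_le_card hsub).trans ((Finset.card_union_le _ _).trans
    (Nat.add_le_add_left ((Finset.card_union_le _ _).trans
      (Nat.add_le_add_left Finset.card_image_le _)) _))
  have h2 : ((hyperbolaPairs M).card : ℝ) ≤ _ := Nat.cast_le.2 h1
  push_cast at h2
  have h3 := card_hyperbolaPairs_filter_fst_lt_le M L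
  have h4 := le_card_hyperbolaPairs M
  linarith

/-! ### Small integers share the colour of 2 -/

/-- The pairs `(x, y)` of integers at least `2` with `x * y ≤ N` for which `x`, `y` and `x * y`
all have colour `i`. -/
def colourPairs (f : ℕ → Fin 2) (N : ℕ) (i : Fin 2) : Finset (ℕ × ℕ) :=
  (Finset.Icc 2 N ×ˢ Finset.Icc 2 N).filter fun p =>
    p.1 * p.2 ≤ N ∧ f p.1 = i ∧ f p.2 = i ∧ f (p.1 * p.2) = i

/-- The pairs `(x, y)` of integers at least `2` with `x * y ≤ N` for which `x`, `y` and `x * y`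
have the same colour. -/
def monoPairs (f : ℕ → Fin 2) (N : ℕ) : Finset (ℕ × ℕ) :=
  colourPairs f N 0 ∪ colourPairs f N 1

theorem mem_colourPairs {f : ℕ → Fin 2} {N : ℕ} {i : Fin 2} {x y : ℕ} :
    (x, y) ∈ colourPairs f N i ↔
      2 ≤ x ∧ 2 ≤ y ∧ x * y ≤ N ∧ f x = i ∧ f y = i ∧ f (x * y) = i := by
  simp only [colourPairs, Finset.mem_filter, Finset.mem_product, Finset.mem_Icc]
  constructor
  · tauto
  · rintro ⟨h1, h2, h3, h4⟩
    exact ⟨⟨⟨h1, by nlinarith⟩, h2, by nlinarith⟩, h3, h4⟩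

theorem mem_monoPairs {f : ℕ → Fin 2} {N x y : ℕ} :
    (x, y) ∈ monoPairs f N ↔ 2 ≤ x ∧ 2 ≤ y ∧ x * y ≤ N ∧ f x = f y ∧ f y = f (x * y) := by
  rw [monoPairs, Finset.mem_union, mem_colourPairs, mem_colourPairs]
  have h1 : f y = 0 ∨ f y = 1 := by omega
  grind

theorem fin_two_eq_of_ne_of_ne {a b c : Fin 2} (h1 : a ≠ c) (h2 : b ≠ c) : a = b := by
  omega

/-- The pairs `(p, q)` for which the product of `p` and `q * y` is considered when `2` and `x` have
different colours. -/
def testPairs (x : ℕ) : Finset (ℕ × ℕ) :=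
  ([(2, 1), (x, 1), (2, x), (x, 2), (2 * x, 1), (2, 2), (x, 4), (2 * x, 2),
    (2, 2 * x)] : List (ℕ × ℕ)).toFinset

theorem card_testPairs_le (x : ℕ) : (testPairs x).card ≤ 9 := List.toFinset_card_le _

theorem testPairs_bounds {x : ℕ} (hx2 : 2 ≤ x) :
    ∀ t ∈ testPairs x, 2 ≤ t.1 ∧ 1 ≤ t.2 ∧ t.1 * t.2 ≤ 4 * x := by
  simp only [testPairs, List.mem_toFinset, List.mem_cons, List.not_mem_nil, or_false,
    forall_eq_or_imp, forall_eq]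
  refine ⟨?_, ?_, ?_, ?_, ?_, ?_, ?_, ?_, ?_⟩ <;> omega

theorem exists_mono_of_ne (f : ℕ → Fin 2) {x : ℕ} (hx : f x ≠ f 2) (y : ℕ) :
    ∃ t ∈ testPairs x,
      f t.1 = f (t.2 * y) ∧ f (t.2 * y) = f (t.1 * (t.2 * y)) := by
  by_contra! h
  simp only [testPairs, List.mem_toFinset, List.mem_cons, List.not_mem_nil, or_false, forall_eq_or_imp,
    forall_eq, one_mul] at h
  obtain ⟨h1, h2, h3, h4, h5, h6, h7, h8, h9⟩ := h
  rw [show 2 * (x * y) = 2 * x * y by ring] at h3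
  rw [show x * (2 * y) = 2 * x * y by ring] at h4
  rw [show 2 * (2 * y) = 4 * y by ring] at h6
  rw [show x * (4 * y) = 4 * x * y by ring] at h7
  rw [show 2 * x * (2 * y) = 4 * x * y by ring] at h8
  rw [show 2 * (2 * x * y) = 4 * x * y by ring] at h9
  generalize f (2 * x * y) = a at *
  generalize f (4 * x * y) = b at *
  generalize f (x * y) = c at *
  generalize f (2 * y) = d at *
  generalize f (4 * y) = e at *
  generalize f y = g at *
  generalize f (2 * x) = h at *
  generalize f x = i at *
  generalize f 2 = j at *
  -- Let `2` be R and `x` be B. If `y` is R, avoiding monochromatic triples forces `2y` B, `2xy` R,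
  -- `2x` B, `4xy` B. If `y` is B, it forces `xy` R, `2xy` B, `2x` R, `2y` R, `4y` B, `4xy` R.
  -- Either way `2x`, `2y`, `4xy` agree.
  omega

/-- For each of the nine test pairs, `y` can be recovered from the monochromatic pair it yields, so
each pair of `monoPairs` is used at most nine times. The `+ 1` is for `y = 1`. -/
theorem le_card_monoPairs_of_ne (f : ℕ → Fin 2) {N x Y : ℕ} (hx2 : 2 ≤ x) (hx : f x ≠ f 2)
    (hY : 4 * x * Y ≤ N) : Y ≤ 9 * (monoPairs f N).card + 1 := by
  have hsub : Finset.Icc 2 Y ⊆ (testPairs x).biUnion fun t =>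
      (Finset.Icc 2 Y).filter fun y => (t.1, t.2 * y) ∈ monoPairs f N := by
    intro y hy
    have ⟨t, ht, h1, h2⟩ := exists_mono_of_ne f hx y
    have ⟨k1, k2, k3⟩ := testPairs_bounds hx2 t ht
    have hy' := Finset.mem_Icc.1 hy
    refine Finset.mem_biUnion.2 ⟨t, ht, Finset.mem_filter.2 ⟨hy, mem_monoPairs.2
      ⟨k1, by nlinarith, ?_, h1, h2⟩⟩⟩
    calc t.1 * (t.2 * y) = t.1 * t.2 * y := by ring
      _ ≤ 4 * x * Y := Nat.mul_le_mul k3 hy'.2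
      _ ≤ N := hY
  have hcard := (Finset.card_le_card hsub).trans
    (Finset.card_biUnion_le_card_mul (testPairs x) _ (monoPairs f N).card fun t ht => ?_)
  · rw [Nat.card_Icc] at hcard
    have := Nat.mul_le_mul_right (monoPairs f N).card (card_testPairs_le x)
    omega
  · refine Finset.card_le_card_of_injOn (fun y => (t.1, t.2 * y)) ?_ ?_
    · intro y hy
      exact (Finset.mem_filter.1 hy).2
    · intro y _ z _ hyz
      exact Nat.eq_of_mul_eq_mul_left (testPairs_bounds hx2 t ht).2.1 (Prod.mk.inj hyz).2

/-! ### Exceptional integers -/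

theorem card_filter_mul_eq_le (P : Finset (ℕ × ℕ)) {n : ℕ} (hn : n ≠ 0) :
    (P.filter fun p => p.1 * p.2 = n).card ≤ n.divisors.card := by
  refine Finset.card_le_card_of_injOn Prod.fst ?_ ?_
  · rintro ⟨a, b⟩ hab
    have := (Finset.mem_filter.1 hab).2
    simp only [Finset.mem_coe, Nat.mem_divisors]
    exact ⟨⟨b, this.symm⟩, hn⟩
  · rintro ⟨a, b⟩ hab ⟨a', b'⟩ hab' haa
    have h1 := (Finset.mem_filter.1 hab).2
    have h2 := (Finset.mem_filter.1 hab').2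
    dsimp only at haa h1 h2
    subst haa
    have ha : 0 < a := Nat.pos_of_ne_zero fun h => by subst h; omega
    exact Prod.ext rfl (Nat.eq_of_mul_eq_mul_left ha (h1.trans h2.symm))

/-- For `z, w ∈ E`, consider the colours of `2^k z w` and `z w`. If the first is not that of `2`,
then `(2^k z, w)` is monochromatic; if the second is not, `(z, w)` is; if both are, `(2^k, z w)` is.
The first two maps are injective, and the third has fibres bounded by the number of divisors of `z
w`. -/
theorem card_sq_le_of_pow_two_mul_ne (f : ℕ → Fin 2) {N k D : ℕ} (hk : 1 ≤ k)
    (hk2 : f (2 ^ k) = f 2) (hD : ∀ n ≤ N, n.divisors.card ≤ D) (E : Finset ℕ)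
    (hE : ∀ z ∈ E, 2 ≤ z ∧ 2 * z ^ 2 ≤ N ∧ (2 ^ k * z) ^ 2 ≤ 2 * N ∧ f z ≠ f 2 ∧
      f (2 ^ k * z) ≠ f 2) :
    E.card ^ 2 ≤ (2 + D) * (monoPairs f N).card := by
  classical
  set S := monoPairs f N
  set P1 := (E ×ˢ E).filter fun p => (2 ^ k * p.1, p.2) ∈ S
  set P2 := (E ×ˢ E).filter fun p => (p.1, p.2) ∈ S
  set P3 := (E ×ˢ E).filter fun p => (2 ^ k, p.1 * p.2) ∈ S
  have h2k : 2 ≤ 2 ^ k := by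
    calc 2 = 2 ^ 1 := rfl
      _ ≤ 2 ^ k := Nat.pow_le_pow_right (by norm_num) hk
  have hsub : E ×ˢ E ⊆ P1 ∪ (P2 ∪ P3) := by
    rintro ⟨z, w⟩ h
    obtain ⟨hz, hw⟩ := Finset.mem_product.1 h
    obtain ⟨z1, z2, z3, z4, z5⟩ := hE z hz
    obtain ⟨w1, w2, w3, w4, w5⟩ := hE w hw
    simp only [P1, P2, P3, Finset.mem_union, Finset.mem_filter, h, true_and, S, mem_monoPairs]
    -- Multiply `(2^k z)^2 ≤ 2N` by `2w^2 ≤ N`.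
    have hle : 2 ^ k * z * w ≤ N := by
      have : (2 ^ k * z * w) ^ 2 ≤ N ^ 2 := by
        have := Nat.mul_le_mul z3 w2
        nlinarith
      exact (Nat.pow_le_pow_iff_left two_ne_zero).1 this
    have hle' : z * w ≤ N := by nlinarith [Nat.zero_le (z * w)]
    by_cases c1 : f (2 ^ k * z * w) = f 2
    · by_cases c2 : f (z * w) = f 2
      · right; right
        exact ⟨h2k, by nlinarith, by rwa [← mul_assoc], by rw [hk2, c2],
          by rw [← mul_assoc, c1, c2]⟩
      · right; left
        exact ⟨z1, w1, hle', fin_two_eq_of_ne_of_ne z4 w4, fin_two_eq_of_ne_of_ne w4 c2⟩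
    · left
      exact ⟨by nlinarith, w1, hle, fin_two_eq_of_ne_of_ne z5 w4,
        fin_two_eq_of_ne_of_ne w4 c1⟩
  have hP1 : P1.card ≤ S.card := by
    refine Finset.card_le_card_of_injOn (fun p => (2 ^ k * p.1, p.2)) ?_ ?_
    · intro p hp; exact (Finset.mem_filter.1 hp).2
    · rintro ⟨a, b⟩ _ ⟨a', b'⟩ _ hab
      obtain ⟨h1, h2⟩ := Prod.mk.inj hab
      exact Prod.ext (Nat.eq_of_mul_eq_mul_left (by positivity) h1) h2
  have hP2 : P2.card ≤ S.card := Finset.card_le_card fun p hp => (Finset.mem_filter.1 hp).2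
  have hP3 : P3.card ≤ D * S.card := by
    refine Finset.card_le_mul_card_image_of_maps_to (f := fun p : ℕ × ℕ => (2 ^ k, p.1 * p.2))
      (fun p hp => (Finset.mem_filter.1 hp).2) D ?_
    rintro ⟨m, n⟩ hmn
    have hmem := mem_monoPairs.1 hmn
    have hn : n ≤ N := by nlinarith
    refine le_trans ?_ (hD n hn)
    refine le_trans (Finset.card_le_card fun p hp => ?_)
      (card_filter_mul_eq_le P3 (show n ≠ 0 by omega))
    exact Finset.mem_filter.2 ⟨(Finset.mem_filter.1 hp).1,
      (Prod.mk.inj (Finset.mem_filter.1 hp).2).2⟩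
  have h1 := (Finset.card_le_card hsub).trans ((Finset.card_union_le _ _).trans
    (Nat.add_le_add_left (Finset.card_union_le _ _) _))
  rw [Finset.card_product] at h1
  nlinarith

/-- For `0 < z` and `2 * z ^ 2 ≤ N`, the exponent `k` with `N < 2 * (2 ^ k * z) ^ 2 ≤ 4 * N`. -/
def liftExponent (N z : ℕ) : ℕ := Nat.log 4 (4 * N / (2 * z ^ 2))

theorem liftExponent_spec {N z : ℕ} (hz : 0 < z) (hzN : 2 * z ^ 2 ≤ N) :
    1 ≤ liftExponent N z ∧ N < 2 * (2 ^ liftExponent N z * z) ^ 2 ∧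
      (2 ^ liftExponent N z * z) ^ 2 ≤ 2 * N := by
  have hz2 : 0 < 2 * z ^ 2 := by positivity
  have h4 : 4 ≤ 4 * N / (2 * z ^ 2) := by
    rw [Nat.le_div_iff_mul_le hz2]; omega
  set k := liftExponent N z with hk
  have hsq : 2 * (2 ^ k * z) ^ 2 = 4 ^ k * (2 * z ^ 2) := by
    rw [show 4 = 2 ^ 2 by norm_num, ← pow_mul]; ring
  have hlow : 4 ^ k * (2 * z ^ 2) ≤ 4 * N :=
    (Nat.le_div_iff_mul_le hz2).1 (Nat.pow_log_le_self 4 (by omega))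
  have hhigh : 4 * N < 4 ^ (k + 1) * (2 * z ^ 2) :=
    (Nat.div_lt_iff_lt_mul hz2).1 (Nat.lt_pow_succ_log_self (by norm_num) _)
  refine ⟨Nat.log_pos (by norm_num) h4, ?_, ?_⟩
  · rw [hsq]; rw [pow_succ] at hhigh; nlinarith
  · omega

/-- The `z` with `2 * z ^ 2 ≤ N` such that neither `z` nor some `2 ^ k * z` with `1 ≤ k ≤ L` and
`(2 ^ k * z) ^ 2 ≤ 2 * N` has the colour of `2`. -/
def exceptionalSet (f : ℕ → Fin 2) (N L : ℕ) : Finset ℕ :=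
  (Finset.Icc 1 L).biUnion fun k => (Finset.Icc 2 N).filter fun z =>
    2 * z ^ 2 ≤ N ∧ (2 ^ k * z) ^ 2 ≤ 2 * N ∧ f z ≠ f 2 ∧ f (2 ^ k * z) ≠ f 2

/-- If `2^k ≥ L`, then `z` is at most `√(2N) / L` and so has the colour of `2`. Thus `k ≤ L` loses
no exponent, and `2^k` is itself small enough to have the colour of `2`. -/
theorem two_pow_lt_of_ne {f : ℕ → Fin 2} {N L k z : ℕ}
    (hred : ∀ x, 2 ≤ x → x ^ 2 * L ^ 2 ≤ 2 * N → f x = f 2) (hz : 2 ≤ z) (hfz : f z ≠ f 2)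
    (hk : (2 ^ k * z) ^ 2 ≤ 2 * N) : 2 ^ k < L := by
  by_contra! h
  refine hfz (hred z hz (le_trans ?_ hk))
  rw [mul_pow, mul_comm]
  gcongr

theorem card_exceptionalSet_le (f : ℕ → Fin 2) {N L D : ℕ}
    (hred : ∀ x, 2 ≤ x → x ^ 2 * L ^ 2 ≤ 2 * N → f x = f 2) (hL4 : L ^ 4 ≤ 2 * N)
    (hD : ∀ n ≤ N, n.divisors.card ≤ D) :
    ((exceptionalSet f N L).card : ℝ) ≤ L * √((2 + D) * (monoPairs f N).card) := by
  have h : ∀ k ∈ Finset.Icc 1 L, (((Finset.Icc 2 N).filter fun z =>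
      2 * z ^ 2 ≤ N ∧ (2 ^ k * z) ^ 2 ≤ 2 * N ∧ f z ≠ f 2 ∧ f (2 ^ k * z) ≠ f 2).card : ℝ) ≤
      √((2 + D) * (monoPairs f N).card) := by
    intro k hk
    set E := (Finset.Icc 2 N).filter fun z =>
      2 * z ^ 2 ≤ N ∧ (2 ^ k * z) ^ 2 ≤ 2 * N ∧ f z ≠ f 2 ∧ f (2 ^ k * z) ≠ f 2 with hE
    have hE' : ∀ z ∈ E, 2 ≤ z ∧ 2 * z ^ 2 ≤ N ∧ (2 ^ k * z) ^ 2 ≤ 2 * N ∧ f z ≠ f 2 ∧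
        f (2 ^ k * z) ≠ f 2 := fun z hz => by
      rw [hE, Finset.mem_filter, Finset.mem_Icc] at hz
      exact ⟨hz.1.1, hz.2⟩
    rcases E.eq_empty_or_nonempty with he | ⟨z, hz⟩
    · simp only [he, Finset.card_empty, Nat.cast_zero]; positivity
    obtain ⟨z1, z2, z3, z4, z5⟩ := hE' z hz
    have hkL := two_pow_lt_of_ne hred z1 z4 z3
    have hk1 := (Finset.mem_Icc.1 hk).1
    have h2k : 2 ≤ 2 ^ k := le_self_pow₀ (by norm_num : 1 ≤ 2) (by omega)
    have hk2 : f (2 ^ k) = f 2 := by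
      refine hred _ h2k (le_trans ?_ hL4)
      calc (2 ^ k) ^ 2 * L ^ 2 ≤ L ^ 2 * L ^ 2 := by gcongr
        _ = L ^ 4 := by ring
    have := card_sq_le_of_pow_two_mul_ne f hk1 hk2 hD E hE'
    refine Real.le_sqrt_of_sq_le ?_
    exact_mod_cast this
  refine (Nat.cast_le.2 Finset.card_biUnion_le).trans ?_
  push_cast
  exact (Finset.sum_le_sum h).trans_eq (by simp)

theorem mem_exceptionalSet_of_ne {f : ℕ → Fin 2} {N L k z : ℕ}
    (hred : ∀ x, 2 ≤ x → x ^ 2 * L ^ 2 ≤ 2 * N → f x = f 2) (hz : 2 ≤ z) (hzN : 2 * z ^ 2 ≤ N)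
    (hfz : f z ≠ f 2) (hk1 : 1 ≤ k) (hk : (2 ^ k * z) ^ 2 ≤ 2 * N) (hfk : f (2 ^ k * z) ≠ f 2) :
    z ∈ exceptionalSet f N L := by
  have h1 := two_pow_lt_of_ne hred hz hfz hk
  have h2 : k < 2 ^ k := Nat.lt_two_pow_self
  refine Finset.mem_biUnion.2 ⟨k, Finset.mem_Icc.2 ⟨hk1, by omega⟩, Finset.mem_filter.2
    ⟨Finset.mem_Icc.2 ⟨hz, by nlinarith⟩, hzN, hk, hfz, hfk⟩⟩

/-! ### The lifting injection -/

/-- Keeps a pair `(a, b)` if `a * b` has the colour of `2`, and otherwise multiplies `b` by the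
power of `2` that moves `a * b` just above `√(N / 2)`. -/
def liftPair (f : ℕ → Fin 2) (N : ℕ) (p : ℕ × ℕ) : ℕ × ℕ :=
  if f (p.1 * p.2) = f 2 then p else (p.1, 2 ^ liftExponent N (p.1 * p.2) * p.2)

theorem liftPair_mem_colourPairs {f : ℕ → Fin 2} {N L a b : ℕ}
    (hred : ∀ x, 2 ≤ x → x ^ 2 * L ^ 2 ≤ 2 * N → f x = f 2) (hL : 2 ≤ L)
    (ha : L ≤ a) (hb : L ≤ b) (hab : 2 * (a * b) ^ 2 ≤ N) (hE : a * b ∉ exceptionalSet f N L) :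
    liftPair f N (a, b) ∈ colourPairs f N (f 2) := by
  have hz : 2 ≤ a * b := by nlinarith
  have hfa : f a = f 2 := hred a (by omega) <| by
    calc a ^ 2 * L ^ 2 ≤ a ^ 2 * b ^ 2 := by gcongr
      _ ≤ 2 * N := by rw [← mul_pow]; omega
  unfold liftPair
  split_ifs with h
  · dsimp only at h
    refine mem_colourPairs.2 ⟨by omega, by omega, by nlinarith, hfa, hred b (by omega) ?_, h⟩
    calc b ^ 2 * L ^ 2 ≤ b ^ 2 * a ^ 2 := by gcongr
      _ ≤ 2 * N := by rw [← mul_pow, mul_comm b]; omega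
  · dsimp only at h ⊢
    obtain ⟨k1, k2, k3⟩ := liftExponent_spec (by omega) hab
    generalize liftExponent N (a * b) = k at *
    have hpos : 1 ≤ 2 ^ k := Nat.one_le_two_pow
    have heq : a * (2 ^ k * b) = 2 ^ k * (a * b) := by ring
    refine mem_colourPairs.2 ⟨by omega, by nlinarith, ?_, hfa, hred _ (by nlinarith) ?_, ?_⟩
    · rw [heq]
      have : 2 ≤ 2 ^ k * (a * b) := by nlinarith
      nlinarith
    · calc (2 ^ k * b) ^ 2 * L ^ 2 ≤ (2 ^ k * b) ^ 2 * a ^ 2 := by gcongr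
        _ = (2 ^ k * (a * b)) ^ 2 := by ring
        _ ≤ 2 * N := k3
    · rw [heq]
      by_contra hf
      exact hE (mem_exceptionalSet_of_ne hred hz hab h k1 k3 hf)

/-- If two lifts agree, then `b = 2^j b'`. With `j ≥ 1`, both `ab'` and `2^j ab'` miss the colour of
`2`, which makes `ab'` exceptional. -/
theorem liftPair_injective_aux {f : ℕ → Fin 2} {N L a b b' : ℕ}
    (hred : ∀ x, 2 ≤ x → x ^ 2 * L ^ 2 ≤ 2 * N → f x = f 2) (hL : 2 ≤ L)
    (ha : L ≤ a) (hb' : L ≤ b') (hab : 2 * (a * b) ^ 2 ≤ N)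
    (hab' : 2 * (a * b') ^ 2 ≤ N) (hE' : a * b' ∉ exceptionalSet f N L)
    (hf : f (a * b) ≠ f 2) (hf' : f (a * b') ≠ f 2) {k k' : ℕ} (hkk : k ≤ k')
    (h : 2 ^ k * b = 2 ^ k' * b') : b = b' := by
  obtain ⟨j, rfl⟩ := Nat.exists_eq_add_of_le hkk
  have hb : b = 2 ^ j * b' := by
    refine Nat.eq_of_mul_eq_mul_left (show 0 < 2 ^ k by positivity) ?_
    rw [h, pow_add, mul_assoc]
  rcases Nat.eq_zero_or_pos j with rfl | hj
  · simpa using hb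
  have heq : a * b = 2 ^ j * (a * b') := by rw [hb]; ring
  rw [heq] at hf hab
  exact absurd (mem_exceptionalSet_of_ne hred (by nlinarith) hab' hf' hj (by omega) hf) hE'

/-- `liftPair` injects the pairs with non-exceptional product into the solutions in the colour of
`2`. Each exceptional product accounts for at most `D` further pairs. -/
theorem card_truncatedHyperbolaPairs_le (f : ℕ → Fin 2) {N L D : ℕ}
    (hred : ∀ x, 2 ≤ x → x ^ 2 * L ^ 2 ≤ 2 * N → f x = f 2) (hL : 2 ≤ L) (hL4 : L ^ 4 ≤ 2 * N)
    (hD : ∀ n ≤ N, n.divisors.card ≤ D) :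
    ((truncatedHyperbolaPairs L (Nat.sqrt (N / 2))).card : ℝ) ≤
      (colourPairs f N (f 2)).card + D * (L * √((2 + D) * (monoPairs f N).card)) := by
  set P := truncatedHyperbolaPairs L (Nat.sqrt (N / 2))
  set E := exceptionalSet f N L
  have hP : ∀ p ∈ P, L ≤ p.1 ∧ L ≤ p.2 ∧ 2 * (p.1 * p.2) ^ 2 ≤ N := by
    intro p hp
    simp only [P, truncatedHyperbolaPairs, Finset.mem_filter, mem_hyperbolaPairs,
      Nat.le_sqrt'] at hp
    exact ⟨hp.2.1, hp.2.2, by have := hp.1.2.2; omega⟩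
  have h1 : (P.filter fun p => p.1 * p.2 ∈ E).card ≤ D * E.card := by
    refine Finset.card_le_mul_card_image_of_maps_to (f := fun p : ℕ × ℕ => p.1 * p.2)
      (fun p hp => (Finset.mem_filter.1 hp).2) D fun z hz => ?_
    simp only [E, exceptionalSet, Finset.mem_biUnion, Finset.mem_filter, Finset.mem_Icc] at hz
    obtain ⟨k, -, ⟨hz2, hzN⟩, -⟩ := hz
    exact (card_filter_mul_eq_le _ (by omega)).trans (hD z hzN)
  have h2 : (P.filter fun p => ¬ p.1 * p.2 ∈ E).card ≤ (colourPairs f N (f 2)).card := by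
    refine Finset.card_le_card_of_injOn (liftPair f N) ?_ ?_
    · rintro ⟨a, b⟩ hp
      obtain ⟨hp, hpE⟩ := Finset.mem_filter.1 hp
      obtain ⟨p1, p2, p3⟩ := hP _ hp
      exact liftPair_mem_colourPairs hred hL p1 p2 p3 hpE
    · rintro ⟨a, b⟩ hp ⟨a', b'⟩ hq hpq
      obtain ⟨hp, hpE⟩ := Finset.mem_filter.1 hp
      obtain ⟨hq, hqE⟩ := Finset.mem_filter.1 hq
      obtain ⟨p1, p2, p3⟩ := hP _ hp
      obtain ⟨q1, q2, q3⟩ := hP _ hq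
      dsimp only at hpE hqE p1 p2 p3 q1 q2 q3
      have haa : a = a' := by
        have := congrArg Prod.fst hpq
        unfold liftPair at this
        split_ifs at this <;> exact this
      subst haa
      have hzp : 0 < a * b := by nlinarith
      have hzq : 0 < a * b' := by nlinarith
      obtain ⟨_, k2, _⟩ := liftExponent_spec hzp p3
      obtain ⟨_, l2, _⟩ := liftExponent_spec hzq q3
      have hbb := congrArg Prod.snd hpq
      unfold liftPair at hbb
      dsimp only at hbb
      generalize liftExponent N (a * b) = k at *
      generalize liftExponent N (a * b') = k' at *
      refine Prod.ext rfl ?_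
      dsimp only
      -- The mixed cases are impossible by size: an unlifted product `z` has `2z^2 ≤ N`, while a
      -- lifted one violates this.
      split_ifs at hbb with c1 c2 c2
      · exact hbb
      · dsimp only at hbb
        rw [show 2 ^ k' * (a * b') = a * b by rw [hbb]; ring] at l2
        omega
      · dsimp only at hbb
        rw [show 2 ^ k * (a * b) = a * b' by rw [← hbb]; ring] at k2
        omega
      · dsimp only at hbb
        rcases le_total k k' with hk | hk
        · exact liftPair_injective_aux hred hL p1 q2 p3 q3 hqE c1 c2 hk hbb
        · exact (liftPair_injective_aux hred hL p1 p2 q3 p3 hpE c2 c1 hk hbb.symm).symm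
  have h3 := Finset.card_filter_add_card_filter_not (s := P) (fun p => p.1 * p.2 ∈ E)
  have h4 := card_exceptionalSet_le f hred hL4 hD
  calc (P.card : ℝ) ≤ (colourPairs f N (f 2)).card + D * E.card := by
        exact_mod_cast (by omega)
    _ ≤ _ := by gcongr

/-! ### From pairs to non-degenerate solutions -/

/-- A colouring of `{2, …, N}` extended to all natural numbers. -/
def extendColouring {N : ℕ} (c : Finset.Icc 2 N → Fin 2) (n : ℕ) : Fin 2 :=
  -- The default `0` is harmless: pairs in `colourPairs` have both entries and their product in `{2,
  -- …, N}`.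
  if h : n ∈ Finset.Icc 2 N then c ⟨n, h⟩ else 0

theorem mem_colourClass {N : ℕ} {c : Finset.Icc 2 N → Fin 2} {i : Fin 2} {n : ℕ} :
    n ∈ colourClass c i ↔ 2 ≤ n ∧ n ≤ N ∧ extendColouring c n = i := by
  simp only [colourClass, extendColouring, Finset.mem_map, Finset.mem_filter, Finset.mem_univ,
    true_and, Function.Embedding.subtype_apply, Subtype.exists, exists_and_right,
    exists_eq_right, Finset.mem_Icc]
  constructor
  · rintro ⟨h, hc⟩
    exact ⟨h.1, h.2, by rw [dif_pos h]; exact hc⟩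
  · rintro ⟨h1, h2, h3⟩
    rw [dif_pos ⟨h1, h2⟩] at h3
    exact ⟨⟨h1, h2⟩, h3⟩

theorem mem_mulSolutions {A : Finset ℕ} {x y z : ℕ} :
    (x, y, z) ∈ mulSolutions A ↔ x ∈ A ∧ y ∈ A ∧ z ∈ A ∧ x * y = z := by
  simp [mulSolutions, and_assoc]

theorem mem_nondegMulSolutions {A : Finset ℕ} {x y z : ℕ} :
    (x, y, z) ∈ nondegMulSolutions A ↔
      (x ∈ A ∧ y ∈ A ∧ z ∈ A ∧ x * y = z) ∧ x ≠ y ∧ x ≠ z ∧ y ≠ z := by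
  simp [nondegMulSolutions, mem_mulSolutions]

/-- Since the factors are at least `2`, the only possible degeneracy is `x = y`, and then `x ≤ √N`.
-/
theorem card_colourPairs_le {N : ℕ} (c : Finset.Icc 2 N → Fin 2) (i : Fin 2) :
    (colourPairs (extendColouring c) N i).card ≤
      (nondegMulSolutions (colourClass c i)).card + Nat.sqrt N := by
  have hsub : colourPairs (extendColouring c) N i ⊆
      (nondegMulSolutions (colourClass c i)).image (fun s => (s.1, s.2.1)) ∪
        (Finset.Icc 1 (Nat.sqrt N)).image fun x => (x, x) := by
    rintro ⟨x, y⟩ h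
    obtain ⟨hx, hy, hxy, fx, fy, fz⟩ := mem_colourPairs.1 h
    rw [Finset.mem_union, Finset.mem_image, Finset.mem_image]
    rcases eq_or_ne x y with rfl | hne
    · exact Or.inr ⟨x, Finset.mem_Icc.2 ⟨by omega, Nat.le_sqrt.2 hxy⟩, rfl⟩
    · refine Or.inl ⟨(x, y, x * y), mem_nondegMulSolutions.2 ⟨⟨?_, ?_, ?_, rfl⟩, hne, ?_, ?_⟩, rfl⟩
      · exact mem_colourClass.2 ⟨hx, by nlinarith, fx⟩
      · exact mem_colourClass.2 ⟨hy, by nlinarith, fy⟩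
      · exact mem_colourClass.2 ⟨by nlinarith, hxy, fz⟩
      · nlinarith
      · nlinarith
  refine (Finset.card_le_card hsub).trans ((Finset.card_union_le _ _).trans ?_)
  refine Nat.add_le_add Finset.card_image_le (Finset.card_image_le.trans ?_)
  simp

/-! ### The extremal colouring -/

theorem le_natSqrt_half_iff {N n : ℕ} : n ≤ Nat.sqrt (N / 2) ↔ (n : ℝ) ≤ √((N : ℝ) / 2) := by
  rw [Nat.le_sqrt', Real.le_sqrt n.cast_nonneg (by positivity), le_div_iff₀ two_pos,
    Nat.le_div_iff_mul_le two_pos]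
  exact_mod_cast Iff.rfl

theorem mem_colourClass_extremalColouring_zero {N n : ℕ} :
    n ∈ colourClass (extremalColouring N) 0 ↔
      2 ≤ n ∧ n ≤ N ∧ (n ≤ Nat.sqrt (N / 2) ∨ N < 2 * n) := by
  have h : N < 2 * n ↔ (N : ℝ) / 2 < n := by
    rw [div_lt_iff₀ two_pos, mul_comm]; exact_mod_cast Iff.rfl
  rw [mem_colourClass, le_natSqrt_half_iff, h]
  refine and_congr_right fun h1 => and_congr_right fun h2 => ?_
  rw [extendColouring, dif_pos (Finset.mem_Icc.2 ⟨h1, h2⟩), extremalColouring]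
  split_ifs with hn
  · exact iff_of_true rfl hn
  · exact iff_of_false one_ne_zero hn

theorem mem_colourClass_extremalColouring_one {N n : ℕ} :
    n ∈ colourClass (extremalColouring N) 1 ↔
      2 ≤ n ∧ Nat.sqrt (N / 2) < n ∧ 2 * n ≤ N := by
  have h0 := mem_colourClass_extremalColouring_zero (N := N) (n := n)
  rw [mem_colourClass] at h0 ⊢
  generalize extendColouring (extremalColouring N) n = a at *
  omega

theorem mulSolutions_extremalColouring_one (N : ℕ) :
    mulSolutions (colourClass (extremalColouring N) 1) = ∅ := by
  refine Finset.eq_empty_of_forall_notMem ?_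
  rintro ⟨x, y, z⟩ h
  obtain ⟨hx, hy, hz, hxy⟩ := mem_mulSolutions.1 h
  rw [mem_colourClass_extremalColouring_one] at hx hy hz
  have := Nat.mul_le_mul (Nat.succ_le_of_lt hx.2.1) (Nat.succ_le_of_lt hy.2.1)
  have := Nat.lt_succ_sqrt (N / 2)
  omega

/-- A factor above `N/2` would make the product exceed `N`, so both factors are at most `√(N/2)`.
Their product is then at most `N/2`, and being red forces it down to `√(N/2)`. -/
theorem mem_nondegMulSolutions_extremalColouring_zero {N x y z : ℕ} :
    (x, y, z) ∈ nondegMulSolutions (colourClass (extremalColouring N) 0) ↔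
      2 ≤ x ∧ 2 ≤ y ∧ x ≠ y ∧ x * y = z ∧ z ≤ Nat.sqrt (N / 2) := by
  simp only [mem_nondegMulSolutions, mem_colourClass_extremalColouring_zero]
  constructor
  · rintro ⟨⟨⟨x1, x2, x3⟩, ⟨y1, y2, y3⟩, ⟨z1, z2, z3⟩, rfl⟩, hne, -, -⟩
    have hx : x ≤ Nat.sqrt (N / 2) := x3.resolve_right (by nlinarith)
    have hy : y ≤ Nat.sqrt (N / 2) := y3.resolve_right (by nlinarith)
    have := Nat.mul_le_mul hx hy
    have := Nat.sqrt_le (N / 2)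
    exact ⟨x1, y1, hne, rfl, z3.resolve_right (by omega)⟩
  · rintro ⟨x1, y1, hne, rfl, hz⟩
    have := Nat.sqrt_le_self (N / 2)
    have hx : x < x * y := by nlinarith
    have hy : y < x * y := by nlinarith
    refine ⟨⟨⟨x1, by omega, Or.inl (by omega)⟩, ⟨y1, by omega, Or.inl (by omega)⟩,
      ⟨by omega, by omega, Or.inl hz⟩, rfl⟩, hne, hx.ne, hy.ne⟩

theorem card_nondegMulSolutions_extremalColouring_le (N : ℕ) :
    (nondegMulSolutions (colourClass (extremalColouring N) 0)).card ≤
      (hyperbolaPairs (Nat.sqrt (N / 2))).card := by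
  refine Finset.card_le_card_of_injOn (fun s => (s.1, s.2.1)) ?_ ?_
  · rintro ⟨x, y, z⟩ h
    obtain ⟨hx, hy, -, rfl, hz⟩ := mem_nondegMulSolutions_extremalColouring_zero.1 h
    exact mem_hyperbolaPairs.2 ⟨by dsimp only; omega, by dsimp only; omega, hz⟩
  · rintro ⟨x, y, z⟩ h ⟨x', y', z'⟩ h' heq
    obtain ⟨-, -, -, rfl, -⟩ := mem_nondegMulSolutions_extremalColouring_zero.1 h
    obtain ⟨-, -, -, rfl, -⟩ := mem_nondegMulSolutions_extremalColouring_zero.1 h'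
    obtain ⟨rfl, rfl⟩ := Prod.mk.inj heq
    rfl

theorem card_hyperbolaPairs_le_nondegMulSolutions (N : ℕ) :
    (hyperbolaPairs (Nat.sqrt (N / 2))).card ≤
      (nondegMulSolutions (colourClass (extremalColouring N) 0)).card +
        3 * Nat.sqrt (N / 2) := by
  set M := Nat.sqrt (N / 2) with hM
  set I := Finset.Icc 1 M
  have hsub : hyperbolaPairs M ⊆
      (nondegMulSolutions (colourClass (extremalColouring N) 0)).image (fun s => (s.1, s.2.1)) ∪
        (I.image (fun a => (1, a)) ∪ (I.image (fun a => (a, 1)) ∪ I.image fun a => (a, a))) := by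
    rintro ⟨x, y⟩ h
    obtain ⟨hx, hy, hxy⟩ := mem_hyperbolaPairs.1 h
    dsimp only at hx hy hxy
    have hxI : x ∈ I := Finset.mem_Icc.2 ⟨hx, by nlinarith⟩
    have hyI : y ∈ I := Finset.mem_Icc.2 ⟨hy, by nlinarith⟩
    simp only [Finset.mem_union, Finset.mem_image]
    rcases eq_or_ne x 1 with rfl | hx1
    · exact Or.inr (Or.inl ⟨y, hyI, rfl⟩)
    rcases eq_or_ne y 1 with rfl | hy1
    · exact Or.inr (Or.inr (Or.inl ⟨x, hxI, rfl⟩))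
    rcases eq_or_ne x y with rfl | hne
    · exact Or.inr (Or.inr (Or.inr ⟨x, hxI, rfl⟩))
    · exact Or.inl ⟨(x, y, x * y), mem_nondegMulSolutions_extremalColouring_zero.2
        ⟨by omega, by omega, hne, rfl, hxy⟩, rfl⟩
  have hI : I.card = M := by simp [I]
  have h1 := Finset.card_le_card hsub
  have h2 := Finset.card_union_le ((nondegMulSolutions (colourClass (extremalColouring N) 0)).image
    (fun s => (s.1, s.2.1))) (I.image (fun a => (1, a)) ∪ (I.image (fun a => (a, 1)) ∪
      I.image fun a => (a, a)))
  have h3 := Finset.card_union_le (I.image (fun a => (1, a))) (I.image (fun a => (a, 1)) ∪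
      I.image fun a => (a, a))
  have h4 := Finset.card_union_le (I.image (fun a => (a, 1))) (I.image fun a => (a, a))
  have h5 : (I.image (fun a => (1, a))).card ≤ I.card := Finset.card_image_le
  have h6 : (I.image (fun a => (a, 1))).card ≤ I.card := Finset.card_image_le
  have h7 : (I.image (fun a => (a, a))).card ≤ I.card := Finset.card_image_le
  have h8 := Finset.card_image_le (s := nondegMulSolutions (colourClass (extremalColouring N) 0))
    (f := fun s => (s.1, s.2.1))
  omega

/-- With `s = √(N/2)`, `s log s` is the main term minus `s (log 2) / 2`. Rounding `s` down to `M`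
costs `(s - M) log s + M log (s / M)`, which is `O(s)` because `s - M < 1`. -/
theorem natSqrt_half_mul_log_bounds {N : ℕ} (hN : 2 ≤ N) :
    (Nat.sqrt (N / 2) : ℝ) ≤ √(N : ℝ) ∧
    (Nat.sqrt (N / 2) : ℝ) * Real.log (Nat.sqrt (N / 2)) ≤
      1 / (2 * √2) * (√(N : ℝ) * Real.log N) ∧
    1 / (2 * √2) * (√(N : ℝ) * Real.log N) - 3 * √(N : ℝ) ≤
      (Nat.sqrt (N / 2) : ℝ) * Real.log (Nat.sqrt (N / 2)) := by
  have hN' : (2 : ℝ) ≤ N := by exact_mod_cast hN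
  set s := √((N : ℝ) / 2) with hs
  have hM1 : 1 ≤ Nat.sqrt (N / 2) := Nat.le_sqrt.2 (by omega)
  have hMs : (Nat.sqrt (N / 2) : ℝ) ≤ s := le_natSqrt_half_iff.1 le_rfl
  have hsM : s < (Nat.sqrt (N / 2) : ℝ) + 1 := by
    have := (not_congr (le_natSqrt_half_iff (N := N) (n := Nat.sqrt (N / 2) + 1))).1 (by omega)
    push_cast at this
    exact not_le.1 this
  have hM1' : (1 : ℝ) ≤ Nat.sqrt (N / 2) := by exact_mod_cast hM1
  generalize (Nat.sqrt (N / 2) : ℝ) = M at *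
  have hsN : s ≤ √(N : ℝ) := Real.sqrt_le_sqrt (by linarith)
  have hs1 : 1 ≤ s := hM1'.trans hMs
  have hslog : s * Real.log s =
      1 / (2 * √2) * (√(N : ℝ) * Real.log N) - s * (Real.log 2 / 2) := by
    rw [hs, Real.log_sqrt (by positivity), Real.log_div (by positivity) (by norm_num),
      Real.sqrt_div (by positivity)]
    field_simp
  have hlog2 : Real.log 2 ≤ 1 := by have := Real.log_two_lt_d9; linarith
  have hlog2' : 0 ≤ Real.log 2 := Real.log_nonneg (by norm_num)
  refine ⟨hMs.trans hsN, ?_, ?_⟩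
  · calc M * Real.log M ≤ s * Real.log s := by gcongr; exact Real.log_nonneg hM1'
      _ ≤ _ := by rw [hslog]; nlinarith
  · have h1 : M * (Real.log s - Real.log M) ≤ s - M := by
      rw [← Real.log_div (by positivity) (by positivity)]
      calc M * Real.log (s / M) ≤ M * (s / M - 1) := by
            gcongr; exact Real.log_le_sub_one_of_pos (by positivity)
        _ = s - M := by field_simp
    have h2 : (s - M) * Real.log s ≤ s := by
      have h3 := Real.log_le_sub_one_of_pos (show 0 < s by positivity)
      have h4 := Real.log_nonneg hs1
      nlinarith
    nlinarith

theorem nondegMulSolutions_extremalColouring_zero_isBigO :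
    (fun N : ℕ =>
        ((nondegMulSolutions (colourClass (extremalColouring N) 0)).card : ℝ) -
          1 / (2 * √2) * (√(N : ℝ) * Real.log (N : ℝ)))
      =O[atTop] fun N : ℕ => √(N : ℝ) := by
  refine IsBigO.of_bound 7 ?_
  filter_upwards [eventually_ge_atTop 2] with N hN
  obtain ⟨h1, h2, h3⟩ := natSqrt_half_mul_log_bounds hN
  have h4 : ((nondegMulSolutions (colourClass (extremalColouring N) 0)).card : ℝ) ≤ _ :=
    Nat.cast_le.2 (card_nondegMulSolutions_extremalColouring_le N)
  have h5 : ((hyperbolaPairs (Nat.sqrt (N / 2))).card : ℝ) ≤ _ :=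
    Nat.cast_le.2 (card_hyperbolaPairs_le_nondegMulSolutions N)
  push_cast at h5
  have h6 := card_hyperbolaPairs_le (Nat.sqrt (N / 2))
  have h7 := le_card_hyperbolaPairs (Nat.sqrt (N / 2))
  rw [Real.norm_eq_abs, Real.norm_of_nonneg (Real.sqrt_nonneg _), abs_le]
  constructor <;> linarith [Real.sqrt_nonneg (N : ℝ)]

/-! ### Choice of parameters and the lower bound -/

theorem eq_of_sq_mul_sq_le {f : ℕ → Fin 2} {N L : ℕ} {t : ℝ} (hN : 2 ≤ N) (htL : t ≤ L)
    (ht : 300 ≤ t) (hlog : 1 ≤ Real.log N) (hlogt : 300 * Real.log N ≤ t)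
    (hS : ((monoPairs f N).card : ℝ) ≤ 4 * (√(N : ℝ) * Real.log N)) {x : ℕ} (hx : 2 ≤ x)
    (hxL : x ^ 2 * L ^ 2 ≤ 2 * N) : f x = f 2 := by
  by_contra hne
  have h1 := le_card_monoPairs_of_ne f hx hne (N := N) (Y := N / (4 * x)) (Nat.mul_div_le _ _)
  have h2 : N < 4 * x * (N / (4 * x) + 1) := Nat.lt_mul_div_succ N (by omega)
  have h3 : N < 4 * x * (9 * (monoPairs f N).card + 2) :=
    h2.trans_le (Nat.mul_le_mul_left _ (by omega))
  have h4 : (N : ℝ) < 4 * x * (9 * (monoPairs f N).card + 2) := by exact_mod_cast h3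
  set r := √(N : ℝ) with hr
  have hrr : r * r = N := Real.mul_self_sqrt (by positivity)
  have hr1 : 1 ≤ r := by
    rw [hr, Real.one_le_sqrt]; exact_mod_cast (by omega : 1 ≤ N)
  have hxt : (x : ℝ) * t ≤ 3 / 2 * r := by
    have h5 : ((x : ℝ) * L) ^ 2 ≤ 2 * (r * r) := by rw [hrr, mul_pow]; exact_mod_cast hxL
    have h6 : (x : ℝ) * L ≤ 3 / 2 * r := abs_le_of_sq_le_sq' (by nlinarith) (by positivity) |>.2
    exact le_trans (by gcongr) h6
  have h7 : (9 * ((monoPairs f N).card : ℝ) + 2) ≤ 38 * (r * Real.log N) := by nlinarith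
  have hx0 : (0 : ℝ) < x := by exact_mod_cast (by omega : 0 < x)
  have h8 : (N : ℝ) < 4 * x * (38 * (r * Real.log N)) := h4.trans_le (by gcongr)
  -- The chain closes because `152/300 · 3/2 < 1`, with `152 = 4 · 38`, `38 = 9 · 4 + 2` and `3/2`
  -- bounding `√2`.
  have h9 : 4 * x * (38 * (r * Real.log N)) ≤ r * (152 / 300 * (x * t)) := by
    have : (x : ℝ) * (300 * Real.log N) ≤ x * t := by gcongr
    nlinarith
  nlinarith

/-- The finite form of the lower bound: here `t` stands for a small power of `N`. -/
theorem exists_le_card_nondegMulSolutions {ε t : ℝ} {N : ℕ} (hε : 0 < ε) (hN : 2 ≤ N)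
    (ht : 300 ≤ t) (hlog : 1 ≤ Real.log N) (hlogt : 300 * Real.log N ≤ t)
    (htN : t ^ 16 ≤ N) (htε : Real.log t ≤ ε / 8 * Real.log N) (hεN : 24 ≤ ε * Real.log N)
    (hdiv : ∀ n ≤ N, (n.divisors.card : ℝ) ≤ t) (c : Finset.Icc 2 N → Fin 2) :
    ∃ i : Fin 2, (1 / (2 * √2) - ε) * (√(N : ℝ) * Real.log (N : ℝ)) ≤
      ((nondegMulSolutions (colourClass c i)).card : ℝ) := by
  by_contra! hcon
  set f := extendColouring c
  set r := √(N : ℝ) with hr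
  have hrr : r * r = N := Real.mul_self_sqrt (by positivity)
  have hr1 : 1 ≤ r := by
    rw [hr, Real.one_le_sqrt]; exact_mod_cast (by omega : 1 ≤ N)
  have hsqrt : (Nat.sqrt N : ℝ) ≤ r := Real.nat_sqrt_le_real_sqrt
  have hconst : 1 / (2 * √2) ≤ 1 := by
    rw [div_le_one (by positivity)]
    have : 1 ≤ √2 := Real.one_le_sqrt.2 (by norm_num)
    linarith
  have hrl : r ≤ r * Real.log N := by nlinarith
  have hclass (i : Fin 2) : ((colourPairs f N i).card : ℝ) ≤
      (nondegMulSolutions (colourClass c i)).card + r := by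
    have : ((colourPairs f N i).card : ℝ) ≤ _ := Nat.cast_le.2 (card_colourPairs_le c i)
    push_cast at this
    linarith
  -- Each colour contributes at most `r log N` non-degenerate pairs and `r ≤ r log N` squares.
  have hS : ((monoPairs f N).card : ℝ) ≤ 4 * (r * Real.log N) := by
    have h1 : ((monoPairs f N).card : ℝ) ≤ (colourPairs f N 0).card + (colourPairs f N 1).card := by
      exact_mod_cast Finset.card_union_le _ _
    have h2 : (1 / (2 * √2) - ε) * (r * Real.log N) ≤ 1 * (r * Real.log N) := by
      gcongr; linarith
    linarith [hclass 0, hclass 1, hcon 0, hcon 1]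
  set L := ⌈t⌉₊ with hL
  have htL : t ≤ L := Nat.le_ceil t
  have hLt : (L : ℝ) ≤ 2 * t := by
    have := Nat.ceil_lt_add_one (show 0 ≤ t by linarith)
    linarith
  have hred : ∀ x, 2 ≤ x → x ^ 2 * L ^ 2 ≤ 2 * N → f x = f 2 := fun x hx hxL =>
    eq_of_sq_mul_sq_le hN htL ht hlog hlogt hS hx hxL
  have hL2 : 2 ≤ L := by
    have : (2 : ℝ) ≤ L := by linarith
    exact_mod_cast this
  have htr : t ^ 8 ≤ r := by
    refine Real.le_sqrt_of_sq_le ?_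
    rw [← pow_mul]; exact htN
  have hL4 : L ^ 4 ≤ 2 * N := by
    have h1 : (L : ℝ) ^ 4 ≤ 2 * N := by
      calc (L : ℝ) ^ 4 ≤ (2 * t) ^ 4 := by gcongr
        _ = 16 * t ^ 4 := by ring
        _ ≤ t ^ 4 * t ^ 4 := by
          gcongr
          calc (16 : ℝ) ≤ 300 ^ 4 := by norm_num
            _ ≤ t ^ 4 := by gcongr
        _ = t ^ 8 := by ring
        _ ≤ t ^ 16 := pow_le_pow_right₀ (by linarith) (by norm_num)
        _ ≤ 2 * N := by linarith [show (0 : ℝ) ≤ N by positivity]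
    exact_mod_cast h1
  have hDt : (⌊t⌋₊ : ℝ) ≤ t := Nat.floor_le (by linarith)
  have hmain := card_truncatedHyperbolaPairs_le f (D := ⌊t⌋₊) hred hL2 hL4
    fun n hn => Nat.le_floor (hdiv n hn)
  have herr : (⌊t⌋₊ : ℝ) * (L * √((2 + ⌊t⌋₊) * (monoPairs f N).card)) ≤ r := by
    have h1 : (2 + (⌊t⌋₊ : ℝ)) * (monoPairs f N).card ≤ 8 * t ^ 2 * r := by
      calc (2 + (⌊t⌋₊ : ℝ)) * (monoPairs f N).card ≤ (2 * t) * (4 * (r * t)) := by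
            gcongr
            · linarith
            · refine hS.trans ?_
              gcongr
              linarith
        _ = _ := by ring
    have h2 : √((2 + (⌊t⌋₊ : ℝ)) * (monoPairs f N).card) ≤ √(8 * t ^ 2 * r) :=
      Real.sqrt_le_sqrt h1
    calc _ ≤ t * (2 * t * √(8 * t ^ 2 * r)) := by gcongr
      -- The square of the left side is `32 t^6 r`, so `t^8 ≤ r` suffices; this is the purpose of
      -- `t^16 ≤ N`.
      _ ≤ r := by
        refine abs_le_of_sq_le_sq' ?_ (by positivity) |>.2
        calc (t * (2 * t * √(8 * t ^ 2 * r))) ^ 2 = 4 * t ^ 4 * √(8 * t ^ 2 * r) ^ 2 := by ring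
          _ = 32 * t ^ 6 * r := by rw [Real.sq_sqrt (by positivity)]; ring
          _ ≤ t ^ 2 * t ^ 6 * r := by gcongr; nlinarith
          _ = t ^ 8 * r := by ring
          _ ≤ r * r := by gcongr
          _ = r ^ 2 := by ring
  obtain ⟨b1, -, b3⟩ := natSqrt_half_mul_log_bounds hN
  have hlow := le_card_truncatedHyperbolaPairs (Nat.sqrt (N / 2)) L
  have hlogL : Real.log L ≤ 1 + ε / 8 * Real.log N := by
    calc Real.log L ≤ Real.log (2 * t) := Real.log_le_log (by linarith) hLt
      _ = Real.log 2 + Real.log t := Real.log_mul (by norm_num) (by linarith)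
      _ ≤ _ := by have := Real.log_two_lt_d9; linarith
  have hML : (Nat.sqrt (N / 2) : ℝ) * (1 + Real.log L) ≤ r * (2 + ε / 8 * Real.log N) := by
    have : 0 ≤ Real.log L := Real.log_nonneg (by linarith)
    exact mul_le_mul b1 (by linarith) (by linarith) (by linarith)
  have hfin := hcon (f 2)
  have hf2 := hclass (f 2)
  have hrε : 24 * r ≤ ε * (r * Real.log N) := by nlinarith
  -- The losses total at most `10 r + (ε/4) r log N`, and `24 r ≤ ε r log N` keeps this below `ε r
  -- log N`.
  nlinarith

theorem eventually_exists_le_card_nondegMulSolutions {ε : ℝ} (hε : 0 < ε) :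
    ∀ᶠ N : ℕ in atTop, ∀ c : Finset.Icc 2 N → Fin 2, ∃ i : Fin 2,
      (1 / (2 * √2) - ε) * (√(N : ℝ) * Real.log (N : ℝ)) ≤
        ((nondegMulSolutions (colourClass c i)).card : ℝ) := by
  -- Here `t = N^δ`: `1/16` gives `t^16 ≤ N` and `ε/8` controls `log t`. The divisor bound is taken
  -- with exponent `δ/2` so that its constant is absorbed by another factor `N^(δ/2)`.
  set δ : ℝ := min (1 / 16) (ε / 8)
  have hδ : 0 < δ := lt_min (by norm_num) (by positivity)
  have hδ16 : δ ≤ 1 / 16 := min_le_left _ _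
  have hδε : δ ≤ ε / 8 := min_le_right _ _
  obtain ⟨C, hC1, hC⟩ := exists_card_divisors_le_mul_rpow (half_pos hδ)
  have hcast : Tendsto (fun N : ℕ => (N : ℝ)) atTop atTop := tendsto_natCast_atTop_atTop
  have hlog := Real.tendsto_log_atTop.comp hcast
  have e1 := ((tendsto_rpow_atTop hδ).comp hcast).eventually_ge_atTop 300
  have e2 := ((tendsto_rpow_atTop (half_pos hδ)).comp hcast).eventually_ge_atTop C
  have e3 := hcast.eventually ((isLittleO_log_rpow_atTop hδ).bound (show (0 : ℝ) < 1 / 300 by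
    norm_num))
  filter_upwards [eventually_ge_atTop 2, e1, e2, e3, hlog.eventually_ge_atTop 1,
    hlog.eventually_ge_atTop (24 / ε)] with N hN e1 e2 e3 e4 e5
  simp only [Function.comp_apply] at e1 e2 e4 e5
  have hN1 : (1 : ℝ) ≤ N := by exact_mod_cast (by omega : 1 ≤ N)
  refine exists_le_card_nondegMulSolutions hε hN e1 e4 ?_ ?_ ?_ ?_ ?_
  · rw [Real.norm_of_nonneg (by linarith), Real.norm_of_nonneg (by positivity)] at e3
    linarith
  · rw [← Real.rpow_natCast, ← Real.rpow_mul (by positivity)]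
    calc (N : ℝ) ^ (δ * (16 : ℕ)) ≤ (N : ℝ) ^ (1 : ℝ) := by
          gcongr
          push_cast; linarith
      _ = N := Real.rpow_one _
  · rw [Real.log_rpow (by positivity)]
    gcongr
  · rw [div_le_iff₀ hε] at e5
    linarith
  · intro n hn
    calc (n.divisors.card : ℝ) ≤ C * (n : ℝ) ^ (δ / 2) := hC n
      _ ≤ (N : ℝ) ^ (δ / 2) * (N : ℝ) ^ (δ / 2) := by gcongr
      _ = (N : ℝ) ^ δ := by
        rw [← Real.rpow_add (by positivity)]; congr 1; ring

theorem theorem1p2 :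
    (∀ ε : ℝ, 0 < ε → ∀ᶠ N : ℕ in atTop, ∀ c : Finset.Icc 2 N → Fin 2, ∃ i : Fin 2,
      (1 / (2 * √2) - ε) * (√(N : ℝ) * Real.log (N : ℝ)) ≤
        ((nondegMulSolutions (colourClass c i)).card : ℝ)) ∧
    (∀ N : ℕ, mulSolutions (colourClass (extremalColouring N) 1) = ∅) ∧
    ((fun N : ℕ =>
        ((nondegMulSolutions (colourClass (extremalColouring N) 0)).card : ℝ) -
          1 / (2 * √2) * (√(N : ℝ) * Real.log (N : ℝ)))
      =O[atTop] fun N : ℕ => √(N : ℝ)) :=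
  ⟨fun _ hε => eventually_exists_le_card_nondegMulSolutions hε,
    mulSolutions_extremalColouring_one, nondegMulSolutions_extremalColouring_zero_isBigO⟩
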